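/- Let $v_1,\dots,v_m\in\mathbb Z^n$, let $C=\mathbb R_+v_1+\dots+\mathbb R_+v_m\subset\mathbb R^n$ be the cone they generate, and let $\delta:\mathbb R^n\to\mathbb R$ be a linear form with $\delta(\mathbb Z^n)\subset\mathbb Z$ and $\delta(x)>0$ for all $x\in C$, $x\neq 0$. Let $P=\{x\in C:\delta(x)=1\}$, assume $P\neq\emptyset$, and put $\overline P=\mathrm{conv}(\{0\}\cup P)$. For a rational polytope $X\subset\mathbb R^n$ with affine hull $A=\mathrm{aff}(X)$ let $\mathrm{Vol}(X)$ be the lattice normalized volume of $X$: choose $w\in A$, let $V=A-w$ and let $u_1,\dots,u_d$ be a $\mathbb Z$-basis of $V\cap\mathbb Z^n$; then $\mathrm{Vol}(X)$ is the Lebesgue measure of $X-w$ in $V$, scaled such that the simplex $\mathrm{conv}(0,u_1,\dots,u_d)$ has measure $1$. (a) If $\mathrm{aff}(P)$ contains a point of $\mathbb Z^n$, then $\mathrm{Vol}(P)=\mathrm{Vol}(\overline P)$. (b) In general, there is a smallest positive integer $k$ such that $\mathrm{aff}(kP)$ contains a point of $\mathbb Z^n$, and $\mathrm{Vol}(P)=k\,\mathrm{Vol}(\overline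 P)$. -/

import Mathlib

open scoped Pointwise ENNReal

noncomputable section

namespace LatticeVolume

/-- The inclusion of the lattice `ℤⁿ` into Euclidean space `ℝⁿ`. -/
def intVec (n : ℕ) : (Fin n → ℤ) →ₗ[ℤ] EuclideanSpace ℝ (Fin n) where
  toFun z := WithLp.toLp 2 fun i => (z i : ℝ)
  map_add' x y := by ext i; simp
  map_smul' c x := by ext i; simp

/-- A subset of `ℝⁿ` contains an integral point (a point of `ℤⁿ`). -/
def HasIntegralPoint {n : ℕ} (S : Set (EuclideanSpace ℝ (Fin n))) : Prop :=
  ∃ z : Fin n → ℤ, intVec n z ∈ S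

/-- The lattice `V ∩ ℤⁿ` of a linear subspace `V` of `ℝⁿ`, as a subgroup of `ℤⁿ`. -/
def lattice {n : ℕ} (V : Submodule ℝ (EuclideanSpace ℝ (Fin n))) : Submodule ℤ (Fin n → ℤ) :=
  (V.restrictScalars ℤ).comap (intVec n)

/-- A `ℤ`-basis `u₁, …, u_d` of `V ∩ ℤⁿ`, regarded as a family of vectors of `V`. -/
def latticeBasis {n : ℕ} (V : Submodule ℝ (EuclideanSpace ℝ (Fin n)))
    (i : Fin (Module.finrank ℤ (lattice V))) : V :=
  ⟨intVec n (Module.finBasis ℤ (lattice V) i), (Module.finBasis ℤ (lattice V) i).2⟩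

/-- The unimodular simplex `conv(0, u₁, …, u_d)` in `V`. -/
def unimodularSimplex {n : ℕ} (V : Submodule ℝ (EuclideanSpace ℝ (Fin n))) : Set V :=
  convexHull ℝ (insert 0 (Set.range (latticeBasis V)))

/-- The lattice normalized volume of `X ⊆ ℝⁿ`, taken in the affine hull `A = aff(X)`.
With `w ∈ A`, the set `X` is translated to `X - w`, which lies in the linear subspace
`V = A - w` (the vector span of `X`). There, Lebesgue measure (`volume` of the Euclidean space `V`)
is scaled so that the simplex spanned by `0` and a `ℤ`-basis of `V ∩ ℤⁿ` has measure `1`. -/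
def latticeVol {n : ℕ} (X : Set (EuclideanSpace ℝ (Fin n))) : ℝ≥0∞ :=
  MeasureTheory.volume
      {y : vectorSpan ℝ X |
        (y : EuclideanSpace ℝ (Fin n)) + Classical.epsilon (fun w => w ∈ affineSpan ℝ X) ∈ X} /
    MeasureTheory.volume (unimodularSimplex (vectorSpan ℝ X))

/-- The cone `ℝ₊ v₁ + ⋯ + ℝ₊ v_m` generated by integral vectors `v₁, …, v_m`. -/
def cone {n m : ℕ} (v : Fin m → Fin n → ℤ) : Set (EuclideanSpace ℝ (Fin n)) :=
  {x | ∃ c : Fin m → ℝ, (∀ i, 0 ≤ c i) ∧ x = ∑ i, c i • intVec n (v i)}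

end LatticeVolume

end

/-! Let `L` be the linear span of `P` and `W` its vector span, so that `W` is the kernel of `δ` on
`L`. The values of `δ` on `L ∩ ℤⁿ` are the multiples of some `k > 0`; fix a lattice vector `u` with
`δ u = k`. Then `L ∩ ℤⁿ = ℤu ⊕ (W ∩ ℤⁿ)`, so up to reflection the unimodular simplex of `L` is a
pyramid of height `k` over that of `W` (`volume_unimodularSimplex_eq_mul`), while `conv(0, P)` is a
pyramid of height `1` over `P`. Pyramid volume is `c · height · base` with one constant `c` for both
(`exists_measure_pyramid`). In the quotient defining the normalized volume `c` cancels and the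
factor `k` remains. Finally `aff(jP)` is the level `δ = j` in `L`, which has a lattice point exactly
when `k ∣ j`; hence `k` is the least dilation factor, and (a) is the case `k = 1`. -/

namespace LatticeVolume

open MeasureTheory

/-! ### Volumes of pyramids -/

/-- The convex hull of the origin and a nonempty convex set consists of the multiples of points
of that set by scalars in `[0, 1]`. -/
theorem convexHull_insert_zero_eq_image {F : Type*} [AddCommGroup F] [Module ℝ F] {K : Set F}
    (hK : Convex ℝ K) (hne : K.Nonempty) :
    convexHull ℝ (insert 0 K) = (fun p : ℝ × F => p.1 • p.2) '' (Set.Icc 0 1 ×ˢ K) := by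
  rw [convexHull_insert hne, hK.convexHull_eq, convexJoin_singleton_left]
  ext x
  simp only [segment_eq_image, Set.mem_iUnion, Set.mem_image, Set.mem_prod, Prod.exists]
  constructor
  · rintro ⟨y, hy, t, ht, rfl⟩
    exact ⟨t, y, ⟨ht, hy⟩, by simp⟩
  · rintro ⟨t, y, ⟨ht, hy⟩, rfl⟩
    exact ⟨y, hy, t, ht, by simp⟩

theorem lintegral_Icc_div_pow {h : ℝ} (hh : 0 < h) (d : ℕ) :
    ∫⁻ t in Set.Icc 0 h, ENNReal.ofReal |(t / h) ^ d| = ENNReal.ofReal (h / (d + 1)) := by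
  have h1 : ∫⁻ t in Set.Icc 0 h, ENNReal.ofReal |(t / h) ^ d| =
      ∫⁻ t in Set.Icc 0 h, ENNReal.ofReal ((t / h) ^ d) := by
    refine setLIntegral_congr_fun measurableSet_Icc fun t ht => ?_
    have := ht.1
    rw [abs_of_nonneg (by positivity)]
  have hc : Continuous fun t : ℝ => (t / h) ^ d := by fun_prop
  rw [h1, ← ofReal_integral_eq_lintegral_ofReal, integral_Icc_eq_integral_Ioc,
    ← intervalIntegral.integral_of_le hh.le]
  · congr 1
    have : ∫ t in (0 : ℝ)..h, (t / h) ^ d = h • ∫ t in (0 / h)..(h / h), t ^ d :=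
      intervalIntegral.integral_comp_div (fun t => t ^ d) hh.ne'
    rw [this, div_self hh.ne', integral_pow]
    simp
    ring
  · exact hc.continuousOn.integrableOn_compact isCompact_Icc
  · filter_upwards [ae_restrict_mem measurableSet_Icc] with t ht
    have := ht.1
    positivity

/-- In the product of a line with `G`, the measure of the pyramid with apex `0` and base
`{h} × (b + S)`. -/
theorem prod_measure_pyramid {G : Type*} [NormedAddCommGroup G] [NormedSpace ℝ G]
    [FiniteDimensional ℝ G] [MeasurableSpace G] [BorelSpace G] (ν : Measure G)
    [ν.IsAddHaarMeasure] {h : ℝ} (hh : 0 < h) (b : G) {S : Set G} (hS : IsCompact S) :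
    ((volume : Measure ℝ).prod ν)
        ((fun p : ℝ × G => (p.1 * h, p.1 • (b + p.2))) '' (Set.Icc 0 1 ×ˢ S)) =
      ENNReal.ofReal (h / (Module.finrank ℝ G + 1)) * ν S := by
  have hcomp : IsCompact
      ((fun p : ℝ × G => (p.1 * h, p.1 • (b + p.2))) '' (Set.Icc 0 1 ×ˢ S)) :=
    (isCompact_Icc.prod hS).image (by fun_prop)
  rw [Measure.prod_apply hcomp.measurableSet]
  have hsec : ∀ t : ℝ, ν (Prod.mk t ⁻¹'
      ((fun p : ℝ × G => (p.1 * h, p.1 • (b + p.2))) '' (Set.Icc 0 1 ×ˢ S))) =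
      (Set.Icc 0 h).indicator
        (fun t => ENNReal.ofReal |(t / h) ^ Module.finrank ℝ G| * ν S) t := by
    intro t
    by_cases ht : t ∈ Set.Icc 0 h
    · rw [Set.indicator_of_mem ht]
      -- The section at height `t` is the base scaled by `t / h`, so its measure scales by `(t / h)
      -- ^ d`.
      have : Prod.mk t ⁻¹'
          ((fun p : ℝ × G => (p.1 * h, p.1 • (b + p.2))) '' (Set.Icc 0 1 ×ˢ S)) =
          (t / h) • ((fun s => b + s) '' S) := by
        ext x
        simp only [Set.mem_preimage, Set.mem_image, Set.mem_prod, Prod.exists, Prod.mk.injEq,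
          Set.mem_smul_set]
        constructor
        · rintro ⟨r, s, ⟨hr, hs⟩, rfl, rfl⟩
          exact ⟨_, ⟨s, hs, rfl⟩, by rw [mul_div_cancel_right₀ _ hh.ne']⟩
        · rintro ⟨_, ⟨s, hs, rfl⟩, rfl⟩
          exact ⟨t / h, s, ⟨⟨div_nonneg ht.1 hh.le, (div_le_one hh).2 ht.2⟩, hs⟩,
            div_mul_cancel₀ _ hh.ne', rfl⟩
      rw [this, Measure.addHaar_smul, Set.image_add_left, measure_preimage_add]
    · rw [Set.indicator_of_notMem ht]
      convert measure_empty (μ := ν)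
      rw [Set.eq_empty_iff_forall_notMem]
      rintro x ⟨⟨r, s⟩, ⟨hr, hs⟩, hx⟩
      simp only [Prod.mk.injEq] at hx
      exact ht (hx.1 ▸ ⟨mul_nonneg hr.1 hh.le, mul_le_of_le_one_left hh.le hr.2⟩)
  simp_rw [hsec]
  rw [lintegral_indicator measurableSet_Icc, lintegral_mul_const _ (by fun_prop),
    lintegral_Icc_div_pow hh]

/-- Measures of pyramids with apex `0` over sets in the hyperplanes `f = h` are proportional to
`h` times the measure of the base. -/
theorem exists_measure_pyramid {F G : Type*} [NormedAddCommGroup F] [NormedSpace ℝ F]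
    [FiniteDimensional ℝ F] [MeasurableSpace F] [BorelSpace F] [NormedAddCommGroup G]
    [NormedSpace ℝ G] [FiniteDimensional ℝ G] [MeasurableSpace G] [BorelSpace G]
    (μ : Measure F) [μ.IsAddHaarMeasure] (ν : Measure G) [ν.IsAddHaarMeasure]
    (i : G →ₗ[ℝ] F) (hi : Function.Injective i) (f : F →ₗ[ℝ] ℝ)
    (hf : ∀ x, f x = 0 ↔ x ∈ Set.range i) {e : F} (he : f e = 1) :
    ∃ c : ℝ≥0∞, c ≠ 0 ∧ c ≠ ⊤ ∧ ∀ a : F, 0 < f a → ∀ S : Set G, IsCompact S → Convex ℝ S →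
      S.Nonempty → μ (convexHull ℝ (insert 0 ((fun s => a + i s) '' S))) =
        c * (ENNReal.ofReal (f a) * ν S) := by
  have hfi : ∀ w, f (i w) = 0 := fun w => (hf _).2 ⟨w, rfl⟩
  -- In these coordinates `f` is the first projection, and `μ` is a constant multiple of the product
  -- measure.
  let φl : ℝ × G →ₗ[ℝ] F := (LinearMap.toSpanSingleton ℝ F e).coprod i
  have hφl : ∀ p, φl p = p.1 • e + i p.2 := fun p => by simp [φl]
  have hbij : Function.Bijective φl := by
    constructor
    · rw [injective_iff_map_eq_zero]
      rintro ⟨t, w⟩ h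
      rw [hφl] at h
      have ht : t = 0 := by simpa [he, hfi] using congrArg f h
      subst ht
      have : i w = i 0 := by simpa using h
      simp [hi this]
    · intro x
      obtain ⟨w, hw⟩ := (hf (x - f x • e)).1 (by simp [he])
      exact ⟨(f x, w), by rw [hφl]; simp [hw]⟩
  let φ : (ℝ × G) ≃L[ℝ] F := (LinearEquiv.ofBijective φl hbij).toContinuousLinearEquiv
  have hφ : ∀ p, φ p = p.1 • e + i p.2 := hφl
  have hm : Measure.IsAddHaarMeasure (μ.map φ.symm) := φ.symm.isAddHaarMeasure_map μ
  have hμ := Measure.isAddLeftInvariant_eq_smul (μ.map φ.symm) ((volume : Measure ℝ).prod ν)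
  set C := Measure.addHaarScalarFactor (μ.map φ.symm) ((volume : Measure ℝ).prod ν) with hC
  have hC0 : 0 < C := Measure.addHaarScalarFactor_pos_of_isAddHaarMeasure _ _
  have hd : (0 : ℝ) < (Module.finrank ℝ G + 1 : ℝ)⁻¹ := by positivity
  refine ⟨C * ENNReal.ofReal (Module.finrank ℝ G + 1 : ℝ)⁻¹, ?_, ?_, ?_⟩
  · simp only [ne_eq, mul_eq_zero, ENNReal.coe_eq_zero, ENNReal.ofReal_eq_zero, not_or, not_le]
    exact ⟨hC0.ne', hd⟩
  · exact ENNReal.mul_ne_top ENNReal.coe_ne_top ENNReal.ofReal_ne_top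
  intro a ha S hS hconv hne
  obtain ⟨b, hb⟩ := (hf (a - f a • e)).1 (by simp [he])
  have hconv' : Convex ℝ ((fun s => a + i s) '' S) := by
    have := (hconv.linear_image i).translate a
    rwa [Set.image_image] at this
  have himg : convexHull ℝ (insert 0 ((fun s => a + i s) '' S)) = φ.symm ⁻¹'
      ((fun p : ℝ × G => (p.1 * f a, p.1 • (b + p.2))) '' (Set.Icc 0 1 ×ˢ S)) := by
    rw [convexHull_insert_zero_eq_image hconv' (hne.image _)]
    have : ∀ r : ℝ, ∀ s : G, φ (r * f a, r • (b + s)) = r • (a + i s) := by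
      intro r s
      rw [hφ]
      simp only [map_smul, map_add, hb]
      module
    ext x
    simp only [Set.mem_image, Set.mem_prod, Prod.exists, Set.mem_preimage]
    constructor
    · rintro ⟨r, _, ⟨hr, s, hs, rfl⟩, rfl⟩
      exact ⟨r, s, ⟨hr, hs⟩, by rw [← this, φ.symm_apply_apply]⟩
    · rintro ⟨r, s, ⟨hr, hs⟩, h⟩
      exact ⟨r, _, ⟨hr, s, hs, rfl⟩, by rw [← this, h, φ.apply_symm_apply]⟩
  have hcomp : IsCompact
      ((fun p : ℝ × G => (p.1 * f a, p.1 • (b + p.2))) '' (Set.Icc 0 1 ×ˢ S)) :=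
    (isCompact_Icc.prod hS).image (by fun_prop)
  rw [himg, ← Measure.map_apply φ.symm.continuous.measurable hcomp.measurableSet, hμ,
    Measure.smul_apply, prod_measure_pyramid ν ha b hS, div_eq_mul_inv,
    ENNReal.ofReal_mul ha.le, ENNReal.smul_def, smul_eq_mul]
  ring

/-! ### Lattice bases and unimodular simplices -/

/-- The simplices spanned by `0` and two `ℤ`-bases of the same full lattice have the same
measure. -/
theorem measure_convexHull_insert_zero_range_eq {E : Type*} [NormedAddCommGroup E]
    [NormedSpace ℝ E] [FiniteDimensional ℝ E] [MeasurableSpace E] [BorelSpace E]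
    (μ : Measure E) [μ.IsAddHaarMeasure] (Λ : Submodule ℤ E) [DiscreteTopology Λ]
    [IsZLattice ℝ Λ] {ι ι' : Type*} [Fintype ι] [Fintype ι'] (b : Module.Basis ι ℤ Λ)
    (b' : Module.Basis ι' ℤ Λ) :
    μ (convexHull ℝ (insert 0 (Set.range fun i => (b i : E)))) =
      μ (convexHull ℝ (insert 0 (Set.range fun i => (b' i : E)))) := by
  classical
  let b₂ := b'.reindex (b'.indexEquiv b)
  have hr : (Set.range fun i => (b' i : E)) = Set.range fun i => (b₂ i : E) := by
    have : (fun i => (b₂ i : E)) = (fun i => (b' i : E)) ∘ (b'.indexEquiv b).symm := by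
      ext i; simp [b₂]
    rw [this, Set.range_comp, (b'.indexEquiv b).symm.range_eq_univ, Set.image_univ]
  rw [hr]
  let B := b.ofZLatticeBasis ℝ Λ
  have hB : ∀ i, B i = b i := fun i => b.ofZLatticeBasis_apply ℝ Λ i
  let T : E →ₗ[ℝ] E := B.constr ℝ fun i => (b₂ i : E)
  have hT : ∀ i, T (b i) = b₂ i := fun i => by
    rw [← hB]; simp [T]
  have himg : convexHull ℝ (insert 0 (Set.range fun i => (b₂ i : E))) =
      T '' convexHull ℝ (insert 0 (Set.range fun i => (b i : E))) := by
    rw [LinearMap.image_convexHull, Set.image_insert_eq, map_zero, ← Set.range_comp]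
    congr 3
    ext i
    simp [hT]
  -- The change of basis is an invertible integer matrix, so its determinant is `±1`.
  have hmat : LinearMap.toMatrix B B T = (b.toMatrix b₂).map (Int.castRingHom ℝ) := by
    ext i j
    rw [LinearMap.toMatrix_apply, hB, hT, Matrix.map_apply, Module.Basis.toMatrix_apply]
    exact b.ofZLatticeBasis_repr_apply ℝ Λ (b₂ j) i
  have hdet : |LinearMap.det T| = 1 := by
    rw [← LinearMap.det_toMatrix B, hmat, ← RingHom.mapMatrix_apply, ← RingHom.map_det]
    have hu : IsUnit (b.toMatrix b₂).det := b.isUnit_det b₂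
    rcases Int.isUnit_iff.1 hu with h | h <;> simp [h]
  rw [himg, Measure.addHaar_image_linearMap, hdet]
  simp

theorem intVec_injective (n : ℕ) : Function.Injective (intVec n) := by
  intro x y h
  ext i
  have := congrArg (fun v : EuclideanSpace ℝ (Fin n) => v i) h
  simpa [intVec] using this

/-- The lattice `V ∩ ℤⁿ`, as a subgroup of `V`. -/
noncomputable def sublattice {n : ℕ} (V : Submodule ℝ (EuclideanSpace ℝ (Fin n))) : Submodule ℤ V :=
  ZLattice.comap ℝ (Submodule.span ℤ (Set.range (EuclideanSpace.basisFun (Fin n) ℝ).toBasis))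
    V.subtype

theorem mem_sublattice_iff {n : ℕ} {V : Submodule ℝ (EuclideanSpace ℝ (Fin n))} {x : V} :
    x ∈ sublattice V ↔ ∃ z, intVec n z = x := by
  change (x : EuclideanSpace ℝ (Fin n)) ∈
    Submodule.span ℤ (Set.range (EuclideanSpace.basisFun (Fin n) ℝ).toBasis) ↔ _
  rw [Module.Basis.mem_span_iff_repr_mem]
  simp only [Set.mem_range, OrthonormalBasis.coe_toBasis_repr_apply,
    EuclideanSpace.basisFun_repr]
  constructor
  · intro h
    choose z hz using h
    exact ⟨z, by ext i; simpa [intVec] using hz i⟩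
  · rintro ⟨z, hz⟩ i
    exact ⟨z i, by rw [← hz]; simp [intVec]⟩

instance {n : ℕ} (V : Submodule ℝ (EuclideanSpace ℝ (Fin n))) :
    DiscreteTopology (sublattice V) :=
  ZLattice.comap_discreteTopology ℝ _ V.subtypeL.continuous Subtype.val_injective

/-- The map from `V ∩ ℤⁿ`, as a subgroup of `ℤⁿ`, to `V ∩ ℤⁿ`, as a subgroup of `V`. -/
noncomputable def latticeMap {n : ℕ} (V : Submodule ℝ (EuclideanSpace ℝ (Fin n))) :
    lattice V →ₗ[ℤ] sublattice V where
  toFun z := ⟨⟨intVec n z, z.2⟩, mem_sublattice_iff.2 ⟨z, rfl⟩⟩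
  map_add' x y := Subtype.ext (Subtype.ext ((intVec n).map_add x y))
  map_smul' c x := Subtype.ext (Subtype.ext ((intVec n).map_smul c (x : Fin n → ℤ)))

theorem latticeMap_bijective {n : ℕ} (V : Submodule ℝ (EuclideanSpace ℝ (Fin n))) :
    Function.Bijective (latticeMap V) := by
  constructor
  · intro x y h
    exact Subtype.ext (intVec_injective n
      (congrArg (fun u : sublattice V => ((u : V) : EuclideanSpace ℝ (Fin n))) h))
  · rintro ⟨x, hx⟩
    obtain ⟨z, hz⟩ := mem_sublattice_iff.1 hx
    exact ⟨⟨z, by change intVec n z ∈ V; rw [hz]; exact x.2⟩, Subtype.ext (Subtype.ext hz)⟩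

/-- The two descriptions of the lattice `V ∩ ℤⁿ` agree. -/
noncomputable def latticeEquiv {n : ℕ} (V : Submodule ℝ (EuclideanSpace ℝ (Fin n))) :
    lattice V ≃ₗ[ℤ] sublattice V :=
  LinearEquiv.ofBijective (latticeMap V) (latticeMap_bijective V)

/-- For a rational subspace `V`, any `ℤ`-basis of `V ∩ ℤⁿ` gives a simplex with the same volume
as the unimodular simplex. -/
theorem volume_unimodularSimplex {n : ℕ} {V : Submodule ℝ (EuclideanSpace ℝ (Fin n))}
    (hV : V ≤ Submodule.span ℝ (intVec n '' lattice V)) {ι : Type*} [Fintype ι]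
    (b : Module.Basis ι ℤ (lattice V)) :
    volume (unimodularSimplex V) =
      volume (convexHull ℝ (insert 0 (Set.range fun i => (⟨intVec n (b i), (b i).2⟩ : V)))) := by
  have : IsZLattice ℝ (sublattice V) := by
    constructor
    rw [eq_top_iff]
    rintro x -
    have hmap : (Submodule.span ℝ (sublattice V : Set V)).map V.subtype =
        Submodule.span ℝ (intVec n '' lattice V) := by
      rw [Submodule.map_span]
      congr 1
      ext y
      constructor
      · rintro ⟨x, hx, rfl⟩
        obtain ⟨z, hz⟩ := mem_sublattice_iff.1 hx
        exact ⟨z, by change intVec n z ∈ V; rw [hz]; exact x.2, hz⟩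
      · rintro ⟨z, hz, rfl⟩
        exact ⟨⟨intVec n z, hz⟩, mem_sublattice_iff.2 ⟨z, rfl⟩, rfl⟩
    obtain ⟨y, hy, hyx⟩ := hmap.ge (hV x.2)
    rwa [← Subtype.ext hyx]
  exact measure_convexHull_insert_zero_range_eq volume (sublattice V)
    ((Module.finBasis ℤ (lattice V)).map (latticeEquiv V)) (b.map (latticeEquiv V))

/-! ### Spans of sets lying in a level of a linear form -/

section Spans

variable {E : Type*} [AddCommGroup E] [Module ℝ E]

theorem vectorSpan_convexHull_insert_zero (Q : Set E) :
    vectorSpan ℝ (convexHull ℝ (insert 0 Q)) = Submodule.span ℝ Q := by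
  rw [← direction_affineSpan, affineSpan_convexHull, direction_affineSpan,
    vectorSpan_eq_span_vsub_set_right ℝ (Set.mem_insert 0 Q)]
  simp

theorem mem_vectorSpan_iff_of_apply_eq {δ : E →ₗ[ℝ] ℝ} {Q : Set E} (hQ : Q.Nonempty) {j : ℝ}
    (hj : j ≠ 0) (h : ∀ q ∈ Q, δ q = j) {x : E} :
    x ∈ vectorSpan ℝ Q ↔ x ∈ Submodule.span ℝ Q ∧ δ x = 0 := by
  obtain ⟨p, hp⟩ := hQ
  constructor
  · intro hx
    rw [vectorSpan_eq_span_vsub_set_right ℝ hp] at hx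
    induction hx using Submodule.span_induction with
    | mem y hy =>
      obtain ⟨q, hq, rfl⟩ := hy
      exact ⟨Submodule.sub_mem _ (Submodule.subset_span hq) (Submodule.subset_span hp),
        by simp [h q hq, h p hp]⟩
    | zero => simp
    | add y z _ _ hy hz => exact ⟨Submodule.add_mem _ hy.1 hz.1, by simp [hy.2, hz.2]⟩
    | smul c y _ hy => exact ⟨Submodule.smul_mem _ c hy.1, by simp [hy.2]⟩
  · rintro ⟨hx, hx0⟩
    -- Projection onto `ker δ` along `p`: it sends each `q ∈ Q` to `q - p` and fixes every `x` with
    -- `δ x = 0`.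
    have key : ∀ y ∈ Submodule.span ℝ Q, y - (δ y / j) • p ∈ vectorSpan ℝ Q := by
      intro y hy
      induction hy using Submodule.span_induction with
      | mem q hq =>
        rw [h q hq, div_self hj, one_smul]
        exact vsub_mem_vectorSpan ℝ hq hp
      | zero => simp
      | add y z _ _ hy hz =>
        convert Submodule.add_mem _ hy hz using 1
        rw [map_add]
        module
      | smul c y _ hy =>
        convert Submodule.smul_mem _ c hy using 1
        rw [map_smul, smul_eq_mul]
        module
    simpa [hx0] using key x hx

theorem mem_affineSpan_iff_of_apply_eq {δ : E →ₗ[ℝ] ℝ} {Q : Set E} (hQ : Q.Nonempty) {j : ℝ}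
    (hj : j ≠ 0) (h : ∀ q ∈ Q, δ q = j) {x : E} :
    x ∈ affineSpan ℝ Q ↔ x ∈ Submodule.span ℝ Q ∧ δ x = j := by
  obtain ⟨p, hp⟩ := hQ
  have hmem : x ∈ affineSpan ℝ Q ↔ x - p ∈ vectorSpan ℝ Q := by
    rw [← direction_affineSpan]
    exact (AffineSubspace.vsub_right_mem_direction_iff_mem
      (subset_affineSpan ℝ Q hp) x).symm
  rw [hmem, mem_vectorSpan_iff_of_apply_eq ⟨p, hp⟩ hj h,
    Submodule.sub_mem_iff_left _ (Submodule.subset_span hp), map_sub, h p hp, sub_eq_zero]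

end Spans

/-! ### Normalized volume and the unimodular simplex of the span -/

/-- The normalized volume may be computed with any base point of the affine hull. -/
theorem latticeVol_eq {n : ℕ} {X : Set (EuclideanSpace ℝ (Fin n))}
    {V : Submodule ℝ (EuclideanSpace ℝ (Fin n))} (hV : vectorSpan ℝ X = V)
    {w : EuclideanSpace ℝ (Fin n)} (hw : w ∈ affineSpan ℝ X) :
    latticeVol X = volume {y : V | (y : EuclideanSpace ℝ (Fin n)) + w ∈ X} /
      volume (unimodularSimplex V) := by
  subst hV
  unfold latticeVol
  congr 1
  set w' := Classical.epsilon fun w => w ∈ affineSpan ℝ X with hw'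
  have hw'mem : w' ∈ affineSpan ℝ X := Classical.epsilon_spec ⟨w, hw⟩
  have hd : w' - w ∈ vectorSpan ℝ X := by
    rw [← direction_affineSpan]
    exact AffineSubspace.vsub_mem_direction hw'mem hw
  rw [← measure_preimage_add_right volume (⟨w' - w, hd⟩ : vectorSpan ℝ X)
    {y : vectorSpan ℝ X | (y : EuclideanSpace ℝ (Fin n)) + w ∈ X}]
  congr 1
  ext y
  simp [add_assoc]

/-- Adjoining `u` to a basis of `W ∩ ℤⁿ` gives a basis of `L ∩ ℤⁿ`: applying `δ` shows independence,
and subtracting a multiple of `u` brings any lattice vector of `L` into `W`. The constant `c` is the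
one from the pyramid formula. -/
theorem volume_unimodularSimplex_eq_mul {n : ℕ}
    {L W : Submodule ℝ (EuclideanSpace ℝ (Fin n))} (hWL : W ≤ L)
    {δ : EuclideanSpace ℝ (Fin n) →ₗ[ℝ] ℝ} (hδW : ∀ x ∈ L, δ x = 0 ↔ x ∈ W)
    (hL : L ≤ Submodule.span ℝ (intVec n '' lattice L))
    {u : Fin n → ℤ} (hu : intVec n u ∈ L) (hδu : 0 < δ (intVec n u))
    (hdvd : ∀ z ∈ lattice L, ∃ q : ℤ, δ (intVec n z) = q * δ (intVec n u))
    {c : ℝ≥0∞} (hc : ∀ a : L, 0 < δ a → ∀ S : Set W, IsCompact S → Convex ℝ S →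
      S.Nonempty → volume (convexHull ℝ (insert 0 ((fun s => a + Submodule.inclusion hWL s) '' S)))
        = c * (ENNReal.ofReal (δ a) * volume S)) :
    volume (unimodularSimplex L) =
      c * (ENNReal.ofReal (δ (intVec n u)) * volume (unimodularSimplex W)) := by
  have hle : lattice W ≤ lattice L := fun z hz => hWL hz
  let b := Module.Basis.mkFinConsOfLE (N := lattice W) (O := lattice L) u hu
    (Module.finBasis ℤ (lattice W)) hle
    (by
      intro r x hx h
      have h0 : δ (intVec n x) = 0 := (hδW _ (hWL hx)).2 hx
      have h1 := congrArg (fun z => δ (intVec n z)) h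
      simp only [map_add, map_smul, h0, map_zero, add_zero] at h1
      rw [← Int.cast_smul_eq_zsmul ℝ, map_smul, smul_eq_mul] at h1
      exact_mod_cast (mul_eq_zero.1 h1).resolve_right hδu.ne')
    (by
      intro z hz
      obtain ⟨q, hq⟩ := hdvd z hz
      refine ⟨-q, ?_⟩
      have hm : intVec n (z + -q • u) ∈ L := by
        exact (lattice L).add_mem hz ((lattice L).smul_mem _ hu)
      refine (hδW _ hm).1 ?_
      rw [map_add, map_smul, ← Int.cast_smul_eq_zsmul ℝ, map_add, map_smul, hq, smul_eq_mul]
      push_cast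
      ring)
  have hb : (b : Fin _ → lattice L) = Fin.cons ⟨u, hu⟩
      (Submodule.inclusion hle ∘ Module.finBasis ℤ (lattice W)) :=
    Module.Basis.coe_mkFinConsOfLE _ _ _ _ _ _
  set a : L := ⟨intVec n u, hu⟩ with ha
  have hrange : (Set.range fun i => (⟨intVec n (b i), (b i).2⟩ : L)) =
      insert a (Submodule.inclusion hWL '' Set.range (latticeBasis W)) := by
    ext y
    rw [hb]
    simp only [Set.mem_range, Fin.exists_fin_succ, Set.mem_insert_iff, Set.mem_image,
      exists_exists_eq_and, Fin.cons_zero, Fin.cons_succ]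
    exact or_congr eq_comm Iff.rfl
  rw [volume_unimodularSimplex hL b, hrange]
  have hneg : volume (unimodularSimplex W) = volume (-unimodularSimplex W) :=
    (Measure.measure_neg _ _).symm
  have hcomp : IsCompact (unimodularSimplex W) :=
    ((Set.finite_range _).insert 0).isCompact_convexHull ℝ
  have hnonempty : (unimodularSimplex W).Nonempty :=
    ⟨0, subset_convexHull ℝ _ (Set.mem_insert _ _)⟩
  rw [hneg]
  have := hc a hδu (-unimodularSimplex W) hcomp.neg (convex_convexHull ℝ _).neg hnonempty.neg
  rw [← this]
  -- The facet spanned by `0` and the basis of `W ∩ ℤⁿ` lies at level `0`, opposite the apex `u`.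
  -- The volume-preserving reflection `x ↦ u - x` puts the apex at `0` and the base at level `δ u`;
  -- this is why `-unimodularSimplex W` appears.
  let r : L ≃ᵃ[ℝ] L := AffineEquiv.constVSub ℝ a
  have hr : ∀ x, r x = a - x := fun x => rfl
  have hvol : ∀ s : Set L, volume (r '' s) = volume s := by
    intro s
    have : r '' s = (fun x => a + x) '' (-s) := by
      rw [← Set.image_neg_eq_neg, Set.image_image]
      exact Set.image_congr fun x _ => by rw [hr, sub_eq_add_neg]
    rw [this, Set.image_add_left, measure_preimage_add, Measure.measure_neg]
  rw [← hvol, ← AffineEquiv.coe_toAffineMap, AffineMap.image_convexHull]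
  congr 1
  let g : W →ᵃ[ℝ] L := r.toAffineMap.comp (Submodule.inclusion hWL).toAffineMap
  have hg : ∀ x, g x = a - Submodule.inclusion hWL x := fun x => rfl
  have h1 : (fun s => a + Submodule.inclusion hWL s) '' (-unimodularSimplex W) =
      convexHull ℝ (g '' (insert 0 (Set.range (latticeBasis W)))) := by
    rw [← AffineMap.image_convexHull, ← Set.image_neg_eq_neg, Set.image_image]
    exact Set.image_congr fun x _ => by rw [hg, map_neg, sub_eq_add_neg]
  rw [h1, Set.insert_eq 0 (convexHull ℝ _), convexHull_convexHull_union_right]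
  congr 1
  rw [Set.image_insert_eq, Set.image_insert_eq, Set.image_insert_eq, Set.image_image,
    AffineEquiv.coe_toAffineMap, hr, hr, hg, map_zero, sub_zero, sub_self, Set.insert_comm]
  rfl

/-! ### Slices of the cone -/

theorem convex_cone {n m : ℕ} (v : Fin m → Fin n → ℤ) : Convex ℝ (cone v) := by
  rintro x ⟨c, hc, rfl⟩ y ⟨d, hd, rfl⟩ s t hs ht -
  refine ⟨fun i => s * c i + t * d i, fun i => ?_, ?_⟩
  · have := hc i
    have := hd i
    positivity
  · simp only [Finset.smul_sum, add_smul, mul_smul, Finset.sum_add_distrib]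

theorem smul_mem_cone {n m : ℕ} {v : Fin m → Fin n → ℤ} {x : EuclideanSpace ℝ (Fin n)}
    (hx : x ∈ cone v) {t : ℝ} (ht : 0 ≤ t) : t • x ∈ cone v := by
  obtain ⟨c, hc, rfl⟩ := hx
  exact ⟨fun i => t * c i, fun i => mul_nonneg ht (hc i), by
    simp only [Finset.smul_sum, mul_smul]⟩

theorem intVec_mem_cone {n m : ℕ} (v : Fin m → Fin n → ℤ) (i : Fin m) :
    intVec n (v i) ∈ cone v := by
  classical
  refine ⟨Pi.single i 1, fun j => ?_, ?_⟩
  · by_cases h : j = i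
    · subst h; simp
    · simp [h]
  · simp [Pi.single_apply]

theorem convex_cone_slice {n m : ℕ} (v : Fin m → Fin n → ℤ)
    (δ : EuclideanSpace ℝ (Fin n) →ₗ[ℝ] ℝ) : Convex ℝ {x | x ∈ cone v ∧ δ x = 1} :=
  (convex_cone v).inter ((convex_singleton (1 : ℝ)).linear_preimage δ)

/-- The slice is a polytope: its points are convex combinations of the nonzero generators rescaled
to level `1`, with weights `c i * δ (v i)`. -/
theorem isCompact_cone_slice {n m : ℕ} {v : Fin m → Fin n → ℤ}
    {δ : EuclideanSpace ℝ (Fin n) →ₗ[ℝ] ℝ} (hδpos : ∀ x ∈ cone v, x ≠ 0 → 0 < δ x) :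
    IsCompact {x | x ∈ cone v ∧ δ x = 1} := by
  have hnn : ∀ i, 0 ≤ δ (intVec n (v i)) := fun i => by
    by_cases h : intVec n (v i) = 0
    · simp [h]
    · exact (hδpos _ (intVec_mem_cone v i) h).le
  set p : Fin m → EuclideanSpace ℝ (Fin n) :=
    fun i => (δ (intVec n (v i)))⁻¹ • intVec n (v i) with hp
  set T := {i | δ (intVec n (v i)) ≠ 0} with hT
  have heq : {x | x ∈ cone v ∧ δ x = 1} = convexHull ℝ (p '' T) := by
    apply Set.Subset.antisymm
    · rintro x ⟨⟨c, hc, rfl⟩, h1⟩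
      simp only [map_sum, map_smul, smul_eq_mul] at h1
      have hsum : ∑ i, c i • intVec n (v i) =
          ∑ i with δ (intVec n (v i)) ≠ 0, (c i * δ (intVec n (v i))) • p i := by
        rw [Finset.sum_filter]
        refine Finset.sum_congr rfl fun i _ => ?_
        split_ifs with h
        · rw [hp, smul_smul, mul_assoc, mul_inv_cancel₀ h, mul_one]
        · have : intVec n (v i) = 0 := by
            by_contra h0
            exact h (hδpos _ (intVec_mem_cone v i) h0).ne'
          rw [this, smul_zero]
      rw [hsum]
      refine (convex_convexHull ℝ _).sum_mem (fun i _ => mul_nonneg (hc i) (hnn i)) ?_ ?_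
      · rw [← h1, Finset.sum_filter]
        refine Finset.sum_congr rfl fun i _ => ?_
        split_ifs with h
        · rfl
        · rw [not_not.1 h, mul_zero]
      · intro i hi
        exact subset_convexHull ℝ _ ⟨i, (Finset.mem_filter.1 hi).2, rfl⟩
    · refine convexHull_min ?_ (convex_cone_slice v δ)
      rintro _ ⟨i, hi, rfl⟩
      exact ⟨smul_mem_cone (intVec_mem_cone v i) (inv_nonneg.2 (hnn i)),
        by rw [hp, map_smul, smul_eq_mul, inv_mul_cancel₀ hi]⟩
  rw [heq]
  exact ((Set.toFinite T).image p).isCompact_convexHull ℝ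

/-! ### Integral values of the form and rationality of the span -/

/-- A linear form that is integral on `ℤⁿ` and positive somewhere on `L ∩ ℤⁿ` maps `L ∩ ℤⁿ` onto
the multiples of its least positive value. -/
theorem exists_generator_of_integral_form {n : ℕ} {L : Submodule ℝ (EuclideanSpace ℝ (Fin n))}
    {δ : EuclideanSpace ℝ (Fin n) →ₗ[ℝ] ℝ}
    (hδint : ∀ z : Fin n → ℤ, ∃ a : ℤ, δ (intVec n z) = (a : ℝ))
    (hpos : ∃ z ∈ lattice L, 0 < δ (intVec n z)) :
    ∃ k : ℕ, 0 < k ∧ (∃ u ∈ lattice L, δ (intVec n u) = k) ∧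
      ∀ z ∈ lattice L, ∃ q : ℤ, δ (intVec n z) = q * (k : ℝ) := by
  classical
  have hex : ∃ k : ℕ, 0 < k ∧ ∃ u ∈ lattice L, δ (intVec n u) = k := by
    obtain ⟨z, hz, h⟩ := hpos
    obtain ⟨a, ha⟩ := hδint z
    have ha0 : 0 < a := by rw [ha] at h; exact_mod_cast h
    lift a to ℕ using ha0.le
    exact ⟨a, by exact_mod_cast ha0, z, hz, by exact_mod_cast ha⟩
  obtain ⟨hk, u, hu, hku⟩ := Nat.find_spec hex
  set k := Nat.find hex with hkdef
  refine ⟨k, hk, ⟨u, hu, hku⟩, fun z hz => ?_⟩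
  obtain ⟨a, ha⟩ := hδint z
  have hk' : (0 : ℤ) < k := by exact_mod_cast hk
  refine ⟨a / k, ?_⟩
  have hr0 := Int.emod_nonneg a hk'.ne'
  have hrk := Int.emod_lt_of_pos a hk'
  have hdiv := Int.emod_add_mul_ediv a k
  have hdivR : ((a % k : ℤ) : ℝ) + k * ((a / k : ℤ) : ℝ) = a := by exact_mod_cast hdiv
  suffices hr : a % k = 0 by
    rw [ha, ← hdivR, hr]
    push_cast
    ring
  -- Otherwise `z - (a / k) • u` has the positive value `a % k < k`, against the minimality of `k`.
  by_contra hne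
  have hrpos : 0 < a % k := lt_of_le_of_ne hr0 (Ne.symm hne)
  obtain ⟨r, hr⟩ := Int.eq_ofNat_of_zero_le hr0
  rw [hr] at hrk hrpos hdivR
  refine Nat.find_min hex (m := r) (by exact_mod_cast hrk) ⟨by exact_mod_cast hrpos,
    z + -(a / k) • u, (lattice L).add_mem hz ((lattice L).smul_mem _ hu), ?_⟩
  rw [map_add, map_smul, ← Int.cast_smul_eq_zsmul ℝ, map_add, map_smul, ha, hku, smul_eq_mul,
    ← hdivR]
  push_cast
  ring

/-- A slice of a cone generated by integral vectors spans a rational subspace. -/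
theorem span_cone_slice_le {n m : ℕ} {v : Fin m → Fin n → ℤ}
    {δ : EuclideanSpace ℝ (Fin n) →ₗ[ℝ] ℝ} (hδpos : ∀ x ∈ cone v, x ≠ 0 → 0 < δ x) :
    Submodule.span ℝ {x | x ∈ cone v ∧ δ x = 1} ≤ Submodule.span ℝ
      (intVec n '' lattice (Submodule.span ℝ {x | x ∈ cone v ∧ δ x = 1})) := by
  have hv : ∀ i, intVec n (v i) ∈ Submodule.span ℝ {x | x ∈ cone v ∧ δ x = 1} := by
    intro i
    by_cases h0 : intVec n (v i) = 0
    · rw [h0]; exact Submodule.zero_mem _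
    have hp := hδpos _ (intVec_mem_cone v i) h0
    have hm : (δ (intVec n (v i)))⁻¹ • intVec n (v i) ∈ {x | x ∈ cone v ∧ δ x = 1} :=
      ⟨smul_mem_cone (intVec_mem_cone v i) (inv_nonneg.2 hp.le),
        by rw [map_smul, smul_eq_mul, inv_mul_cancel₀ hp.ne']⟩
    have := Submodule.smul_mem _ (δ (intVec n (v i))) (Submodule.subset_span hm)
    rwa [smul_smul, mul_inv_cancel₀ hp.ne', one_smul] at this
  refine Submodule.span_le.2 ?_
  rintro _ ⟨⟨c, -, rfl⟩, -⟩
  exact Submodule.sum_mem _ fun i _ =>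
    Submodule.smul_mem _ _ (Submodule.subset_span ⟨v i, hv i, rfl⟩)

/-- A nonempty slice of a cone generated by integral vectors spans a subspace with an integral
vector on which the form is positive. -/
theorem exists_mem_lattice_pos {n m : ℕ} {v : Fin m → Fin n → ℤ}
    {δ : EuclideanSpace ℝ (Fin n) →ₗ[ℝ] ℝ} (hδpos : ∀ x ∈ cone v, x ≠ 0 → 0 < δ x)
    (hne : {x | x ∈ cone v ∧ δ x = 1}.Nonempty) :
    ∃ z ∈ lattice (Submodule.span ℝ {x | x ∈ cone v ∧ δ x = 1}), 0 < δ (intVec n z) := by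
  by_contra! hcon
  obtain ⟨p, hp⟩ := hne
  -- The lattice is closed under negation, so a form that is never positive on it vanishes on it,
  -- hence on its real span, which contains `p`.
  have hδ0 : ∀ z ∈ lattice (Submodule.span ℝ {x | x ∈ cone v ∧ δ x = 1}),
      δ (intVec n z) = 0 := by
    intro z hz
    have h := hcon (-z) ((lattice _).neg_mem hz)
    rw [map_neg, map_neg] at h
    linarith [hcon z hz]
  have hle : Submodule.span ℝ (intVec n '' lattice
      (Submodule.span ℝ {x | x ∈ cone v ∧ δ x = 1})) ≤ LinearMap.ker δ := by
    refine Submodule.span_le.2 ?_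
    rintro _ ⟨z, hz, rfl⟩
    exact hδ0 z hz
  have h0 : δ p = 0 := hle (span_cone_slice_le hδpos (Submodule.subset_span hp))
  rw [hp.2] at h0
  exact one_ne_zero h0

/-! ### Comparison of volumes and the dilation factor -/

/-- A compact convex set `P` in the hyperplane `δ = 1` and the pyramid over `P` with apex `0`:
their normalized volumes differ by the factor `k`, the positive generator of the values of `δ` on
the integral vectors in the span of `P`. -/
theorem latticeVol_eq_mul_latticeVol_pyramid {n : ℕ} {δ : EuclideanSpace ℝ (Fin n) →ₗ[ℝ] ℝ}
    {P : Set (EuclideanSpace ℝ (Fin n))} (hne : P.Nonempty) (hP1 : ∀ p ∈ P, δ p = 1)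
    (hcomp : IsCompact P) (hconv : Convex ℝ P)
    (hL : Submodule.span ℝ P ≤ Submodule.span ℝ (intVec n '' lattice (Submodule.span ℝ P)))
    {k : ℕ} (hk : 0 < k) (hu : ∃ u ∈ lattice (Submodule.span ℝ P), δ (intVec n u) = k)
    (hdvd : ∀ z ∈ lattice (Submodule.span ℝ P), ∃ q : ℤ, δ (intVec n z) = q * (k : ℝ)) :
    latticeVol P = k * latticeVol (convexHull ℝ (insert 0 P)) := by
  obtain ⟨u, hu, hδu⟩ := hu
  obtain ⟨p, hp⟩ := id hne
  set L := Submodule.span ℝ P with hLdef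
  set W := vectorSpan ℝ P with hWdef
  have hW : ∀ x, x ∈ W ↔ x ∈ L ∧ δ x = 0 := fun x =>
    mem_vectorSpan_iff_of_apply_eq hne one_ne_zero hP1
  have hWL : W ≤ L := fun x hx => ((hW x).1 hx).1
  have hpL : p ∈ L := Submodule.subset_span hp
  obtain ⟨c, hc0, hct, hc⟩ := exists_measure_pyramid (volume : Measure L) (volume : Measure W)
    (Submodule.inclusion hWL) (Submodule.inclusion_injective hWL) (δ ∘ₗ L.subtype)
    (fun x => by
      constructor
      · intro h
        exact ⟨⟨x, (hW _).2 ⟨x.2, h⟩⟩, rfl⟩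
      · rintro ⟨y, rfl⟩
        exact ((hW _).1 y.2).2)
    (e := ⟨p, hpL⟩) (hP1 p hp)
  have hsimplex := volume_unimodularSimplex_eq_mul hWL
    (fun x hx => ⟨fun h => (hW x).2 ⟨hx, h⟩, fun h => ((hW x).1 h).2⟩) hL hu
    (by rw [hδu]; exact_mod_cast hk) (by simpa only [hδu] using hdvd) hc
  rw [hδu, ENNReal.ofReal_natCast] at hsimplex
  set S : Set W := {y | (y : EuclideanSpace ℝ (Fin n)) + p ∈ P} with hS
  have hSmem : ∀ x ∈ P, ∃ s ∈ S, p + (s : EuclideanSpace ℝ (Fin n)) = x := fun x hx =>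
    ⟨⟨x - p, vsub_mem_vectorSpan ℝ hx hp⟩, by simpa [hS] using hx, by simp⟩
  have hSimg : (fun s : W => p + (s : EuclideanSpace ℝ (Fin n))) '' S = P := by
    apply Set.Subset.antisymm
    · rintro _ ⟨s, hs, rfl⟩
      simpa [hS, add_comm] using hs
    · intro x hx
      obtain ⟨s, hs, h⟩ := hSmem x hx
      exact ⟨s, hs, h⟩
  have hScomp : IsCompact S := by
    have hcl : Topology.IsClosedEmbedding fun y : W => (y : EuclideanSpace ℝ (Fin n)) + p :=
      (Homeomorph.addRight p).isClosedEmbedding.comp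
        (Submodule.closed_of_finiteDimensional W).isClosedEmbedding_subtypeVal
    exact hcl.isCompact_preimage hcomp
  have hSconv : Convex ℝ S :=
    (hconv.translate_preimage_left p).linear_preimage W.subtype
  have hSne : S.Nonempty := ⟨0, by simpa [hS] using hp⟩
  have hpyr : volume {y : L | (y : EuclideanSpace ℝ (Fin n)) + 0 ∈ convexHull ℝ (insert 0 P)} =
      c * volume S := by
    have h := hc ⟨p, hpL⟩ (by simp [hP1 p hp]) S hScomp hSconv hSne
    rw [show (δ ∘ₗ L.subtype) ⟨p, hpL⟩ = 1 from hP1 p hp, ENNReal.ofReal_one, one_mul] at h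
    rw [← h]
    congr 1
    have himg : L.subtype '' convexHull ℝ
        (insert 0 ((fun s => (⟨p, hpL⟩ : L) + Submodule.inclusion hWL s) '' S)) =
        convexHull ℝ (insert 0 P) := by
      rw [LinearMap.image_convexHull, Set.image_insert_eq, map_zero, Set.image_image]
      conv_rhs => rw [← hSimg]
      rfl
    ext y
    rw [Set.mem_ofPred_eq, add_zero, ← himg]
    exact Subtype.val_injective.mem_set_image
  have h0 : (0 : EuclideanSpace ℝ (Fin n)) ∈ affineSpan ℝ (convexHull ℝ (insert 0 P)) :=
    subset_affineSpan ℝ _ (subset_convexHull ℝ _ (Set.mem_insert _ _))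
  rw [latticeVol_eq hWdef.symm (subset_affineSpan ℝ P hp),
    latticeVol_eq (vectorSpan_convexHull_insert_zero P) h0, hpyr, hsimplex,
    -- Only `c` and `k` are cancelled, so the simplex volume need not be shown positive or finite.
    ENNReal.mul_div_mul_left _ _ hc0 hct, ← mul_div_assoc,
    ENNReal.mul_div_mul_left _ _ (by exact_mod_cast hk.ne') (ENNReal.natCast_ne_top k)]

/-- The least positive dilation factor for which the affine hull of the dilated set contains an
integral point. -/
theorem isLeast_dilation_hasIntegralPoint {n : ℕ} {δ : EuclideanSpace ℝ (Fin n) →ₗ[ℝ] ℝ}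
    {P : Set (EuclideanSpace ℝ (Fin n))} (hne : P.Nonempty) (hP1 : ∀ p ∈ P, δ p = 1)
    {k : ℕ} (hk : 0 < k) (hu : ∃ u ∈ lattice (Submodule.span ℝ P), δ (intVec n u) = k)
    (hdvd : ∀ z ∈ lattice (Submodule.span ℝ P), ∃ q : ℤ, δ (intVec n z) = q * (k : ℝ)) :
    IsLeast {j : ℕ | 0 < j ∧ HasIntegralPoint
      (affineSpan ℝ ((j : ℝ) • P) : Set (EuclideanSpace ℝ (Fin n)))} k := by
  have hmem : ∀ j : ℕ, 0 < j → ∀ x, x ∈ affineSpan ℝ ((j : ℝ) • P) ↔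
      x ∈ Submodule.span ℝ P ∧ δ x = j := by
    intro j hj x
    have hj' : (j : ℝ) ≠ 0 := by exact_mod_cast hj.ne'
    rw [mem_affineSpan_iff_of_apply_eq (hne.smul_set) hj',
      Submodule.span_smul_eq_of_isUnit _ _ (isUnit_iff_ne_zero.2 hj')]
    rintro _ ⟨q, hq, rfl⟩
    simp [hP1 q hq]
  constructor
  · obtain ⟨u, hu, hδu⟩ := hu
    exact ⟨hk, u, (hmem k hk _).2 ⟨hu, hδu⟩⟩
  · rintro j ⟨hj, z, hz⟩
    obtain ⟨hzL, hδz⟩ := (hmem j hj _).1 hz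
    obtain ⟨q, hq⟩ := hdvd z hzL
    rw [hδz] at hq
    have hq' : (j : ℤ) = q * k := by exact_mod_cast hq
    exact Nat.le_of_dvd hj (Int.natCast_dvd_natCast.1 (Dvd.intro_left q hq'.symm))

end LatticeVolume

theorem proposition2p3 {n m : ℕ} (v : Fin m → Fin n → ℤ)
    (δ : EuclideanSpace ℝ (Fin n) →ₗ[ℝ] ℝ)
    (hδint : ∀ z : Fin n → ℤ, ∃ a : ℤ, δ (LatticeVolume.intVec n z) = (a : ℝ))
    (hδpos : ∀ x ∈ LatticeVolume.cone v, x ≠ 0 → 0 < δ x)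
    (P : Set (EuclideanSpace ℝ (Fin n)))
    (hP : P = {x | x ∈ LatticeVolume.cone v ∧ δ x = 1})
    (hne : P.Nonempty) :
    (LatticeVolume.HasIntegralPoint (affineSpan ℝ P : Set (EuclideanSpace ℝ (Fin n))) →
      LatticeVolume.latticeVol P = LatticeVolume.latticeVol (convexHull ℝ (insert 0 P))) ∧
    ∃ k : ℕ,
      IsLeast {j : ℕ | 0 < j ∧ LatticeVolume.HasIntegralPoint
        (affineSpan ℝ ((j : ℝ) • P) : Set (EuclideanSpace ℝ (Fin n)))} k ∧
      LatticeVolume.latticeVol P =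
        (k : ℝ≥0∞) * LatticeVolume.latticeVol (convexHull ℝ (insert 0 P)) := by
  subst hP
  have hP1 : ∀ p ∈ {x | x ∈ LatticeVolume.cone v ∧ δ x = 1}, δ p = 1 := fun p hp => hp.2
  obtain ⟨k, hk, hu, hdvd⟩ := LatticeVolume.exists_generator_of_integral_form hδint
    (LatticeVolume.exists_mem_lattice_pos hδpos hne)
  have hleast := LatticeVolume.isLeast_dilation_hasIntegralPoint hne hP1 hk hu hdvd
  have hvol := LatticeVolume.latticeVol_eq_mul_latticeVol_pyramid hne hP1
    (LatticeVolume.isCompact_cone_slice hδpos) (LatticeVolume.convex_cone_slice v δ)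
    (LatticeVolume.span_cone_slice_le hδpos) hk hu hdvd
  refine ⟨fun hint => ?_, k, hleast, hvol⟩
  -- An integral point in `aff(P)` makes `1` an admissible dilation factor.
  have hk1 : k = 1 := le_antisymm (hleast.2 ⟨one_pos, by simpa using hint⟩) hk
  rw [hvol, hk1, Nat.cast_one, one_mul]
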